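/- All rings are commutative. Let $S$ be a local Noetherian ring with maximal ideal $\mathfrak m$ and dimension $d$. Elements $x_1,\dots,x_d\in S$ are called parameters if $V(x_1,\dots,x_d)=V(\mathfrak m)$; they define, via Čech cohomology, the paraclass $1/(x_1\cdots x_d)\in H^d_{\mathfrak m}(S)$. An $S$-algebra $A$ is called parasolid if the image in $H^d_{\mathfrak m}(A)$ of every nonzero paraclass of $H^d_{\mathfrak m}(S)$ is nonzero. An algebra $A$ over a commutative ring $R$ is called universally parasolid if for every local Noetherian $R$-algebra $R'$ the $R'$-algebra $A\otimes_R R'$ is parasolid. For $f_1,\dots,f_n,h\in R$ one says that $h$ belongs universally parasolidly to $f_1,\dots,f_n$ if the forcing algebra $R[T_1,\dots,T_n]/(f_1T_1+\dots+f_nT_n+h)$ is universally parasolid over $R$. If $R$ is a complete local Noetherian domain and $I=(f_1,\dots,f_n)$ is an ideal of $R$, the parasolid closure $I^{\mathrm{ps}}$ consists of those $h\in R$ for which there is a chain $f_{n+1},\dots,f_m=h$, $m>n$, such that $f_i$ belongs universally parasolidly to $f_1,\dots,f_{i-1}$ for $i=n+1,\dots,m$. For an ideal $I$ of an arbitrary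 Noetherian ring $R$, the parasolid closure $I^{\mathrm{ps}}$ consists of those $h\in R$ such that, for every maximal ideal $\mathfrak m$ of $R$ and every minimal prime $\mathfrak q$ of the completion $\widehat{R_{\mathfrak m}}$, the image of $h$ lies in the parasolid closure of the extension of $I$ to $\widehat{R_{\mathfrak m}}/\mathfrak q$. A Noetherian ring $R$ is called pararegular if $I=I^{\mathrm{ps}}$ for every ideal $I\subseteq R$. Theorem. Let $R$ be a regular local ring (of any characteristic, including mixed characteristic) and let $I\subseteq R$ be an ideal. Then $I=I^{\mathrm{ps}}$. Moreover, every regular ring (a Noetherian ring all of whose localizations at prime ideals are regular local rings) is pararegular. -/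

import Mathlib

open scoped TensorProduct

universe u v w

/-! ### The top Čech cohomology of a finite sequence of elements -/

namespace TopCech

variable {R : Type u} [CommRing R] {d : ℕ} (x : Fin d → R)

/-- The localization `M_{x_1 ⋯ x_d}`, the last term of the Čech complex of `M` with respect to
`x_1, …, x_d`. -/
abbrev Last (M : Type v) [AddCommGroup M] [Module R M] : Type (max u v) :=
  LocalizedModule (Submonoid.powers (∏ j, x j)) M

/-- The localization `M_{x_1 ⋯ x_{i-1} x_{i+1} ⋯ x_d}`, the `i`-th summand of the last but one
term of the Čech complex of `M` with respect to `x_1, …, x_d`. -/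
abbrev Penult (i : Fin d) (M : Type v) [AddCommGroup M] [Module R M] : Type (max u v) :=
  LocalizedModule (Submonoid.powers (∏ j ∈ Finset.univ.erase i, x j)) M

theorem isUnit_penult (i : Fin d) (M : Type v) [AddCommGroup M] [Module R M]
    (s : Submonoid.powers (∏ j ∈ Finset.univ.erase i, x j)) :
    IsUnit (algebraMap R (Module.End R (Last x M)) s) := by
  obtain ⟨s, n, rfl⟩ := s
  have h := IsLocalizedModule.map_units
    (S := Submonoid.powers (∏ j, x j))
    (LocalizedModule.mkLinearMap (Submonoid.powers (∏ j, x j)) M)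
    ⟨∏ j, x j, Submonoid.mem_powers _⟩
  simp only [← Finset.mul_prod_erase Finset.univ x (Finset.mem_univ i), map_mul] at h
  simp only [map_pow]
  refine IsUnit.pow n ?_
  rw [Commute.isUnit_mul_iff (Algebra.commute_algebraMap_left _ _)] at h
  exact h.2

/-- The localization map `M_{x_1 ⋯ x_{i-1} x_{i+1} ⋯ x_d} → M_{x_1 ⋯ x_d}`, which is up to sign
the `i`-th component of the last differential of the Čech complex. -/
noncomputable def face (i : Fin d) (M : Type v) [AddCommGroup M] [Module R M] :
    Penult x i M →ₗ[R] Last x M :=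
  IsLocalizedModule.lift (Submonoid.powers (∏ j ∈ Finset.univ.erase i, x j))
    (LocalizedModule.mkLinearMap _ M) (LocalizedModule.mkLinearMap _ M) (isUnit_penult x i M)

/-- The image of the last differential of the Čech complex
`⨁_i M_{x_1 ⋯ x_{i-1} x_{i+1} ⋯ x_d} → M_{x_1 ⋯ x_d}`. -/
noncomputable def boundaries (M : Type v) [AddCommGroup M] [Module R M] :
    Submodule R (Last x M) :=
  ⨆ i, LinearMap.range (face x i M)

/-- The top Čech cohomology module `H^d(x_1, …, x_d; M)`: the cokernel of the last differential
of the Čech complex. For a system of parameters `x` of a local Noetherian ring `R` with maximal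
ideal `𝔪` this is the local cohomology module `H^d_𝔪(M)`. -/
abbrev H (M : Type v) [AddCommGroup M] [Module R M] : Type (max u v) :=
  Last x M ⧸ boundaries x M

variable {M : Type v} [AddCommGroup M] [Module R M] {N : Type w} [AddCommGroup N] [Module R N]

/-- The map `M_{x_1 ⋯ x_d} → N_{x_1 ⋯ x_d}` induced by a linear map `M → N`. -/
noncomputable def lastMap (f : M →ₗ[R] N) : Last x M →ₗ[R] Last x N :=
  IsLocalizedModule.map (Submonoid.powers (∏ j, x j))
    (LocalizedModule.mkLinearMap _ M) (LocalizedModule.mkLinearMap _ N) f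

theorem boundaries_le_comap (f : M →ₗ[R] N) :
    boundaries x M ≤ (boundaries x N).comap (lastMap x f) := by
  refine iSup_le fun i => ?_
  let S := Submonoid.powers (∏ j ∈ Finset.univ.erase i, x j)
  have key : lastMap x f ∘ₗ face x i M = face x i N ∘ₗ
      IsLocalizedModule.map S (LocalizedModule.mkLinearMap S M)
        (LocalizedModule.mkLinearMap S N) f := by
    refine IsLocalizedModule.ext S (LocalizedModule.mkLinearMap S M) (isUnit_penult x i N) ?_
    ext m
    simp only [LinearMap.comp_apply, face, lastMap, S, IsLocalizedModule.lift_apply,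
      IsLocalizedModule.map_apply]
  rintro _ ⟨y, rfl⟩
  exact (le_iSup (fun i => LinearMap.range (face x i N)) i)
    ⟨_, (LinearMap.congr_fun key y).symm⟩

/-- The map `H^d(x_1, …, x_d; M) → H^d(x_1, …, x_d; N)` induced by a linear map `M → N`. -/
noncomputable def map (f : M →ₗ[R] N) : H x M →ₗ[R] H x N :=
  Submodule.mapQ _ _ (lastMap x f) (boundaries_le_comap x f)

/-- The class of `1 / (x_1 ⋯ x_d)` in `H^d(x_1, …, x_d; R)`. -/
noncomputable def paraclass : H x R :=
  (boundaries x R).mkQ (LocalizedModule.mk 1 ⟨∏ j, x j, Submonoid.mem_powers _⟩)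

end TopCech

/-! ### Parasolid algebras -/

/-- Elements `x_1, …, x_d` of a local ring `R` are parameters if `d = dim R` and
`V(x_1, …, x_d) = V(𝔪)`. -/
def IsParameterSystem {R : Type u} [CommRing R] [IsLocalRing R] {d : ℕ} (x : Fin d → R) : Prop :=
  ringKrullDim R = d ∧
    PrimeSpectrum.zeroLocus (Set.range x) =
      PrimeSpectrum.zeroLocus (IsLocalRing.maximalIdeal R : Set R)

/-- An algebra `A` over a local (Noetherian) ring `R` of dimension `d` is parasolid if for every
system of parameters `x_1, …, x_d` of `R` whose paraclass `1 / (x_1 ⋯ x_d)` is nonzero in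
`H^d_𝔪(R)`, the image of this paraclass in `H^d_𝔪(A)` is nonzero. -/
def IsParasolid (R : Type u) [CommRing R] [IsLocalRing R]
    (A : Type v) [CommRing A] [Algebra R A] : Prop :=
  ∀ (d : ℕ) (x : Fin d → R), IsParameterSystem x →
    TopCech.paraclass x ≠ 0 →
      TopCech.map x (Algebra.linearMap R A) (TopCech.paraclass x) ≠ 0

/-- An algebra `A` over a commutative ring `R` is universally parasolid if the base change of `A`
to every local Noetherian `R`-algebra `R'` is a parasolid `R'`-algebra. -/
def IsUniversallyParasolid (R : Type u) [CommRing R]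
    (A : Type v) [CommRing A] [Algebra R A] : Prop :=
  ∀ (R' : Type u) [CommRing R'] [IsLocalRing R'] [IsNoetherianRing R'] [Algebra R R'],
    IsParasolid R' (R' ⊗[R] A)

/-! ### Parasolid closure -/

/-- The forcing algebra `R[T_1, …, T_n] / (f_1 T_1 + ⋯ + f_n T_n + h)`. -/
abbrev ForcingAlgebra {R : Type u} [CommRing R] {n : ℕ} (f : Fin n → R) (h : R) : Type u :=
  MvPolynomial (Fin n) R ⧸ Ideal.span
    {∑ i, MvPolynomial.C (f i) * MvPolynomial.X i + MvPolynomial.C h}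

/-- `h` belongs universally parasolidly to `f_1, …, f_n`. -/
def BelongsUniversallyParasolidly {R : Type u} [CommRing R] {n : ℕ} (f : Fin n → R) (h : R) :
    Prop :=
  IsUniversallyParasolid R (ForcingAlgebra f h)

/-- `ParasolidChain f h` says that there is a chain `f_{n+1}, …, f_m = h` with `m > n` such that
each `f_i`, `n < i ≤ m`, belongs universally parasolidly to `f_1, …, f_{i-1}`. -/
inductive ParasolidChain {R : Type u} [CommRing R] : {n : ℕ} → (Fin n → R) → R → Prop
  | last {n : ℕ} (f : Fin n → R) (h : R) :
      BelongsUniversallyParasolidly f h → ParasolidChain f h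
  | step {n : ℕ} (f : Fin n → R) (g h : R) :
      BelongsUniversallyParasolidly f g → ParasolidChain (Fin.snoc f g : Fin (n + 1) → R) h →
        ParasolidChain f h

/-- Membership in the parasolid closure of an ideal `I` of a local complete Noetherian domain:
there is a chain from some finite system of generators of `I` to `h`. -/
def MemParasolidClosureOfComplete {R : Type u} [CommRing R] (I : Ideal R) (h : R) : Prop :=
  ∃ (n : ℕ) (f : Fin n → R), Ideal.span (Set.range f) = I ∧ ParasolidChain f h

/-- The completion of the localization of `R` at the maximal ideal `m`. -/
abbrev CompletedLocalization {R : Type u} [CommRing R] (m : Ideal R) [m.IsMaximal] : Type u :=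
  AdicCompletion (IsLocalRing.maximalIdeal (Localization.AtPrime m)) (Localization.AtPrime m)

/-- The canonical map from `R` to the quotient of the completion of `R_m` by the ideal `q`. If `q`
is a minimal prime, the target is one of the local complete domains of `R`. -/
noncomputable def toLocalCompleteDomain {R : Type u} [CommRing R] (m : Ideal R) [m.IsMaximal]
    (q : Ideal (CompletedLocalization m)) : R →+* CompletedLocalization m ⧸ q :=
  (Ideal.Quotient.mk q).comp
    ((algebraMap (Localization.AtPrime m) (CompletedLocalization m)).comp
      (algebraMap R (Localization.AtPrime m)))

/-- The parasolid closure of an ideal `I` of a Noetherian ring `R`: all `h ∈ R` whose image in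
every local complete domain of `R` lies in the parasolid closure of the extension of `I`. -/
def parasolidClosure {R : Type u} [CommRing R] (I : Ideal R) : Set R :=
  {h | ∀ (m : Ideal R) [m.IsMaximal], ∀ q ∈ minimalPrimes (CompletedLocalization m),
    MemParasolidClosureOfComplete (I.map (toLocalCompleteDomain m q))
      (toLocalCompleteDomain m q h)}

/-- A Noetherian ring is pararegular if every ideal equals its parasolid closure. -/
def IsPararegular (R : Type u) [CommRing R] : Prop :=
  IsNoetherianRing R ∧ ∀ I : Ideal R, parasolidClosure I = (I : Set R)

/-!
Only one base change of the forcing algebra matters, the one to the complete regular local ring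
`S = AdicCompletion 𝔪 R_𝔪` itself. Suppose that `∑ f i * t i + h = 0` in an `S`-algebra `A` and that
`h ∉ (f)`. By Krull's intersection theorem `h` is not in `J = (f) + 𝔪 ^ N` for some `N`. If
`x 1, …, x d` is a regular system of parameters, then `S / (x i ^ (N + 1))` is an Artinian local
ring whose socle is generated by the monomial `∏ x i ^ N`, so ideals in it are their own double
annihilators. Hence some `r` multiplies `J` into `(x i ^ (N + 1))` and `h` to `∏ x i ^ N` modulo
these powers (`IsRegularLocalRing.exists_mul_sub_mem`). The forcing equation then puts `∏ x i ^ N`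
into the ideal `(x i ^ (N + 1))` of `A`, which means that the paraclass vanishes over `A`
(`TopCech.map_paraclass_eq_zero`), whereas over `S` it does not
(`IsPermutablyRegular.paraclass_ne_zero`). So `A` is not parasolid.

The double annihilator property comes from a count of lengths
(`exists_mul_eq_zero_and_mul_ne_zero`), the socle from colon formulas for ideals generated by
powers of the `x i` (`IsPermutablyRegular`). These rest on the fact that regular local rings are
domains, so that every part of a regular system of parameters generates a prime ideal
(`IsRegularLocalRing.isPermutablyRegular`). The completion of a regular local ring is Noetherian
(`AdicCompletion.isNoetherianRing`) and of the same dimension by flatness, hence again regular. In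
particular it is a domain, its only minimal prime is zero, and membership in an extended ideal
descends along the faithfully flat map to it and along localizations.

Conversely, if `h ∈ (f)`, the forcing algebra has a retraction to the base ring, which keeps the
paraclass alive after any base change.
-/

/-! ### Ideals generated by powers of a permutably regular family -/

section MonomialIdeals

variable {S : Type*} [CommRing S] {ι : Type*}

/-- Each `x j` is a nonzerodivisor modulo the ideal generated by any of the other elements of the
family. -/
def IsPermutablyRegular (x : ι → S) : Prop :=
  ∀ (T : Finset ι) (j : ι), j ∉ T → ∀ a, x j * a ∈ Ideal.span (x '' T) → a ∈ Ideal.span (x '' T)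

/-- The ideal generated by the powers `x i ^ e i` for `i ∈ T`. -/
def powersIdeal (x : ι → S) (T : Finset ι) (e : ι → ℕ) : Ideal S :=
  Ideal.span ((fun i => x i ^ e i) '' T)

namespace powersIdeal

variable {x : ι → S} {T : Finset ι} {e e' : ι → ℕ} {i j : ι} {a : S}

theorem pow_mem (hi : i ∈ T) : x i ^ e i ∈ powersIdeal x T e :=
  Ideal.subset_span ⟨i, hi, rfl⟩

theorem eq_of_eqOn (h : ∀ i ∈ T, e i = e' i) : powersIdeal x T e = powersIdeal x T e' := by
  unfold powersIdeal
  congr 1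
  exact Set.image_congr fun i hi => by rw [h i hi]

theorem eq_top (hi : i ∈ T) (h : e i = 0) : powersIdeal x T e = ⊤ := by
  rw [Ideal.eq_top_iff_one]
  simpa [h] using pow_mem (x := x) (e := e) hi

theorem mono (h : ∀ i ∈ T, e' i ≤ e i) : powersIdeal x T e ≤ powersIdeal x T e' := by
  refine Ideal.span_le.2 ?_
  rintro _ ⟨i, hi, rfl⟩
  exact Ideal.mem_of_dvd _ (pow_dvd_pow _ (h i hi)) (pow_mem hi)

variable [DecidableEq ι]

theorem mem_iff_erase (hi : i ∈ T) :
    a ∈ powersIdeal x T e ↔ ∃ b, a - x i ^ e i * b ∈ powersIdeal x (T.erase i) e := by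
  have h : powersIdeal x T e = Ideal.span {x i ^ e i} ⊔ powersIdeal x (T.erase i) e := by
    rw [powersIdeal, powersIdeal, ← Ideal.span_union, ← Set.image_singleton
      (f := fun i => x i ^ e i), ← Set.image_union]
    congr 2
    ext k
    by_cases hk : k = i <;> simp [hk, hi]
  rw [h, Ideal.mem_span_singleton_sup]
  constructor
  · rintro ⟨b, c, hc, rfl⟩
    exact ⟨b, by simpa [mul_comm] using hc⟩
  · rintro ⟨b, hb⟩
    exact ⟨b, _, hb, by ring⟩

theorem update_of_notMem {n : ℕ} (hi : i ∉ T) :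
    powersIdeal x T (Function.update e i n) = powersIdeal x T e :=
  eq_of_eqOn fun k hk => Function.update_of_ne (by rintro rfl; exact hi hk) _ _

theorem mem_update_iff {n : ℕ} (hi : i ∈ T) :
    a ∈ powersIdeal x T (Function.update e i n) ↔
      ∃ b, a - x i ^ n * b ∈ powersIdeal x (T.erase i) e := by
  rw [mem_iff_erase hi, update_of_notMem (Finset.notMem_erase i T), Function.update_self]

end powersIdeal

open powersIdeal

namespace IsPermutablyRegular

variable [DecidableEq ι] {x : ι → S}

/-- Regularity persists when the elements are replaced by powers. An exponent at least two is
lowered by comparing `(x i ^ e, Q)`, `(x i ^ (e - 1), Q)` and `(x i, Q)`. -/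
theorem mem_powersIdeal_of_mul_mem (hx : IsPermutablyRegular x) {T : Finset ι} {e : ι → ℕ}
    {j : ι} (hj : j ∉ T) {a : S} (ha : x j * a ∈ powersIdeal x T e) : a ∈ powersIdeal x T e := by
  obtain ⟨N, hN⟩ : ∃ N, ∑ i ∈ T, e i = N := ⟨_, rfl⟩
  induction N using Nat.strong_induction_on generalizing T e j a with
  | _ N ih =>
  subst hN
  by_cases h0 : ∃ i ∈ T, e i = 0
  · obtain ⟨i, hi, h⟩ := h0
    simp [eq_top hi h]
  by_cases h1 : ∃ i ∈ T, 2 ≤ e i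
  swap
  · have h : powersIdeal x T e = Ideal.span (x '' T) := by
      unfold powersIdeal
      congr 1
      refine Set.image_congr fun i hi => ?_
      have : e i = 1 := by
        have h2 : e i ≠ 0 := fun h => h0 ⟨i, hi, h⟩
        have h3 : ¬ 2 ≤ e i := fun h => h1 ⟨i, hi, h⟩
        omega
      simp [this]
    rw [h] at ha ⊢
    exact hx T j hj a ha
  obtain ⟨i, hi, h2⟩ := h1
  have hji : j ∉ T.erase i := fun h => hj (Finset.mem_of_mem_erase h)
  have hii : i ∉ T.erase i := Finset.notMem_erase i T
  have hsum : e i + ∑ k ∈ T.erase i, e k = ∑ k ∈ T, e k := Finset.add_sum_erase T e hi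
  have hupd : ∀ n, ∑ k ∈ T, Function.update e i n k = n + ∑ k ∈ T.erase i, e k := fun n => by
    rw [← Finset.add_sum_erase T _ hi, Function.update_self]
    congr 1
    exact Finset.sum_congr rfl fun k hk => Function.update_of_ne (Finset.ne_of_mem_erase hk) _ _
  have hpow : ∀ {n : ℕ} {b : S}, x i ^ n * b ∈ powersIdeal x (T.erase i) e →
      b ∈ powersIdeal x (T.erase i) e := by
    intro n
    induction n with
    | zero => simp
    | succ n ihn =>
      intro b hb
      exact ihn (ih _ (by omega) hii (by rwa [pow_succ', mul_assoc] at hb) rfl)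
  -- lower the exponent of `x i` by one
  have ha' : a ∈ powersIdeal x T (Function.update e i (e i - 1)) :=
    ih _ (by rw [hupd]; omega) hj
      (mono (fun k hk => by by_cases h : k = i <;> simp [h]) ha) rfl
  -- the cofactor `b` of `x i ^ (e i - 1)` satisfies the hypothesis with `x i` to the power one
  obtain ⟨b, hb⟩ := (mem_update_iff hi).1 ha'
  obtain ⟨c, hc⟩ := (mem_iff_erase hi).1 ha
  have hb1 : x j * b ∈ powersIdeal x T (Function.update e i 1) := by
    refine (mem_update_iff hi).2 ⟨c, hpow (n := e i - 1) ?_⟩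
    have h3 : x i ^ e i = x i ^ (e i - 1) * x i := by
      rw [← pow_succ]; congr 1; omega
    have : x i ^ (e i - 1) * (x j * b - x i ^ 1 * c) =
        (x j * a - x i ^ e i * c) - x j * (a - x i ^ (e i - 1) * b) := by
      rw [h3]; ring
    rw [this]
    exact sub_mem hc (Ideal.mul_mem_left _ _ hb)
  obtain ⟨b', hb'⟩ := (mem_update_iff hi).1 (ih _ (by rw [hupd]; omega) hj hb1 rfl)
  refine (mem_iff_erase hi).2 ⟨b', ?_⟩
  have h3 : x i ^ e i = x i ^ (e i - 1) * x i := by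
    rw [← pow_succ]; congr 1; omega
  have : a - x i ^ e i * b' = (a - x i ^ (e i - 1) * b) +
      x i ^ (e i - 1) * (b - x i ^ 1 * b') := by
    rw [h3]; ring
  rw [this]
  exact add_mem hb (Ideal.mul_mem_left _ _ hb')

/-- Colon formula: dividing by `x j` lowers the exponent of `x j` by one. If that exponent is
already zero, the ideal is the unit ideal, which the truncated subtraction preserves. -/
theorem mem_of_mul_mem (hx : IsPermutablyRegular x) {T : Finset ι} {e : ι → ℕ} {j : ι}
    (hj : j ∈ T) {a : S} (ha : x j * a ∈ powersIdeal x T e) :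
    a ∈ powersIdeal x T (Function.update e j (e j - 1)) := by
  rw [mem_update_iff hj]
  by_cases h0 : e j = 0
  · exact ⟨a, by simp [h0]⟩
  obtain ⟨b, hb⟩ := (mem_iff_erase hj).1 ha
  refine ⟨b, hx.mem_powersIdeal_of_mul_mem (Finset.notMem_erase j T) ?_⟩
  rwa [mul_sub, ← mul_assoc, ← pow_succ', show e j - 1 + 1 = e j by omega]

theorem mem_of_pow_mul_mem (hx : IsPermutablyRegular x) {T : Finset ι} {e : ι → ℕ} {j : ι}
    (hj : j ∈ T) {n : ℕ} {a : S} (ha : x j ^ n * a ∈ powersIdeal x T e) :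
    a ∈ powersIdeal x T (Function.update e j (e j - n)) := by
  induction n generalizing a with
  | zero => simpa using ha
  | succ n ih =>
    have h := hx.mem_of_mul_mem hj (ih (a := x j * a) (by rwa [← mul_assoc, ← pow_succ]))
    rwa [Function.update_self, Function.update_idem, Nat.sub_sub] at h

theorem mem_of_prod_mul_mem (hx : IsPermutablyRegular x) {T U : Finset ι} (hU : U ⊆ T)
    {e : ι → ℕ} {n : ℕ} {a : S} (ha : (∏ i ∈ U, x i ^ n) * a ∈ powersIdeal x T e) :
    a ∈ powersIdeal x T (fun i => if i ∈ U then e i - n else e i) := by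
  induction U using Finset.induction_on generalizing a with
  | empty => simpa using ha
  | insert j U hj ih =>
    rw [Finset.prod_insert hj, mul_comm (x j ^ n), mul_assoc] at ha
    have h := hx.mem_of_pow_mul_mem (hU (Finset.mem_insert_self j U))
      (ih (fun k hk => hU (Finset.mem_insert_of_mem hk)) ha)
    refine (eq_of_eqOn fun k _ => ?_).le h
    by_cases hk : k = j
    · subst hk; simp [hj]
    · simp [hk]

/-- The monomial `∏ x i ^ n` does not lie in the ideal generated by the powers `x i ^ (n + 1)`. -/
theorem prod_pow_notMem (hx : IsPermutablyRegular x) {T : Finset ι}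
    (hT : Ideal.span (x '' T) ≠ ⊤) (n : ℕ) :
    ∏ i ∈ T, x i ^ n ∉ powersIdeal x T (fun _ => n + 1) := by
  intro h
  have h1 := hx.mem_of_prod_mul_mem (a := 1) (Finset.Subset.refl T) (by simpa using h)
  refine hT ((Ideal.eq_top_iff_one _).2 ?_)
  have h2 : (fun i => x i ^ (if i ∈ T then n + 1 - n else n + 1)) '' T = x '' T :=
    Set.image_congr fun i hi => by simp [Finset.mem_coe.1 hi]
  rwa [powersIdeal, h2] at h1

/-- The socle of `S / (x i ^ (n + 1))` is generated by the class of the monomial `∏ x i ^ n`: the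
variables are split off from `a` one after the other by the colon formulas. -/
theorem exists_sub_mem_of_forall_mul_mem (hx : IsPermutablyRegular x) {T : Finset ι}
    {n : ℕ} {a : S} (ha : ∀ j ∈ T, x j * a ∈ powersIdeal x T (fun _ => n + 1)) :
    ∃ c, a - c * ∏ i ∈ T, x i ^ n ∈ powersIdeal x T (fun _ => n + 1) := by
  suffices ∀ U ⊆ T, ∃ c, a - c * ∏ i ∈ U, x i ^ n ∈ powersIdeal x T (fun _ => n + 1) from
    this T (Finset.Subset.refl T)
  intro U
  induction U using Finset.induction_on with
  | empty => exact fun _ => ⟨a, by simp⟩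
  | insert j U hj ih =>
    intro hU
    have hjT : j ∈ T := hU (Finset.mem_insert_self j U)
    have hUT : U ⊆ T := fun k hk => hU (Finset.mem_insert_of_mem hk)
    obtain ⟨c, hc⟩ := ih hUT
    have h1 := hx.mem_of_mul_mem hjT (ha j hjT)
    have h2 : (∏ i ∈ U, x i ^ n) * c ∈
        powersIdeal x T (Function.update (fun _ => n + 1) j (n + 1 - 1)) := by
      have h3 := sub_mem h1 (mono (e' := Function.update (fun _ => n + 1) j (n + 1 - 1))
        (fun k hk => by by_cases h : k = j <;> simp [h]) hc)
      simpa [mul_comm] using h3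
    obtain ⟨c', hc'⟩ := (mem_iff_erase hjT).1 (hx.mem_of_prod_mul_mem hUT h2)
    -- the remaining generators of the colon ideal are killed by the monomial modulo the powers
    have hr : ∀ r ∈ powersIdeal x (T.erase j) (fun i => if i ∈ U then
        Function.update (fun _ => n + 1) j (n + 1 - 1) i - n else
        Function.update (fun _ => n + 1) j (n + 1 - 1) i),
        r * ∏ i ∈ U, x i ^ n ∈ powersIdeal x T (fun _ => n + 1) := by
      intro r hr
      refine Submodule.span_induction ?_ (by simp) (fun a b _ _ ha hb => ?_)
        (fun s a _ ha => ?_) hr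
      · rintro _ ⟨i, hi, rfl⟩
        have hi' := Finset.mem_erase.1 (Finset.mem_coe.1 hi)
        by_cases hiU : i ∈ U
        · rw [← Finset.mul_prod_erase U _ hiU, ← mul_assoc]
          refine Ideal.mul_mem_right _ _ ?_
          simpa [hiU, hi'.1, ← pow_succ'] using
            pow_mem (x := x) (e := fun _ => n + 1) hi'.2
        · refine Ideal.mul_mem_right _ _ ?_
          simpa [hiU, hi'.1] using pow_mem (x := x) (e := fun _ => n + 1) hi'.2
      · rw [add_mul]; exact add_mem ha hb
      · rw [smul_eq_mul, mul_assoc]; exact Ideal.mul_mem_left _ _ ha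
    refine ⟨c', ?_⟩
    have h4 := add_mem hc (hr _ hc')
    have : a - c' * ∏ i ∈ insert j U, x i ^ n = a - c * ∏ i ∈ U, x i ^ n +
        (c - x j ^ n * c') * ∏ i ∈ U, x i ^ n := by
      rw [Finset.prod_insert hj]; ring
    rw [this]
    simpa [hj] using h4

end IsPermutablyRegular

end MonomialIdeals

/-! ### Double annihilators in Artinian local rings with principal socle -/

section Duality

open IsLocalRing

variable {B : Type*} [CommRing B]

/-- A cover `K ⋖ L` of ideals is generated over `K` by any element of `L` outside `K`. -/
theorem CovBy.sup_span_singleton_eq {K L : Ideal B} (h : K ⋖ L) {b : B} (hb : b ∈ L)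
    (hb' : b ∉ K) : K ⊔ Ideal.span {b} = L := by
  refine (h.eq_or_eq le_sup_left
    (sup_le h.le ((Ideal.span_singleton_le_iff_mem _).2 hb))).resolve_left fun h' => hb' ?_
  rw [← h']
  exact Ideal.mem_sup_right (Ideal.mem_span_singleton_self b)

theorem CovBy.length_eq {K L : Ideal B} (h : K ⋖ L) :
    Module.length B L = Module.length B K + 1 := by
  have hs : IsSimpleModule B (L ⧸ Submodule.comap L.subtype K) := (covBy_iff_quot_is_simple h.le).1 h
  rw [Module.length_eq_add_of_exact (Submodule.inclusion h.le) (Submodule.comap L.subtype K).mkQ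
    (Submodule.inclusion_injective h.le) (Submodule.mkQ_surjective _),
    Module.length_eq_one B (L ⧸ _)]
  rw [LinearMap.exact_iff, Submodule.ker_mkQ, Submodule.range_inclusion]

variable [IsLocalRing B]

/-- If the annihilator of the maximal ideal is contained in `(u)`, passing from the annihilator of
`K` to that of a cover `L = K + (b)` of `K` lowers the length by at most one: multiplication by `b`
maps the former into the socle with kernel the latter. -/
theorem CovBy.length_annihilator_le {u : B} (hu : ∀ m ∈ maximalIdeal B, m * u = 0)
    (hsoc : ∀ b, (∀ m ∈ maximalIdeal B, m * b = 0) → b ∈ Ideal.span {u})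
    {K L : Ideal B} (h : K ⋖ L) :
    Module.length B K.annihilator ≤ Module.length B L.annihilator + 1 := by
  obtain ⟨b, hbL, hbK⟩ := SetLike.exists_of_lt h.lt
  -- `L / K` is simple, hence killed by the maximal ideal
  have hmb : ∀ m ∈ maximalIdeal B, m * b ∈ K := by
    intro m hm
    by_contra hmK
    have hb := h.sup_span_singleton_eq (L.mul_mem_left m hbL) hmK ▸ hbL
    obtain ⟨c, k, hk, hc⟩ := Ideal.mem_span_singleton_sup.1 (sup_comm K _ ▸ hb)
    -- `(1 - c m) b ∈ K` and `1 - c m` is a unit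
    have hunit : IsUnit (1 - c * m) := by
      by_contra hn
      refine (maximalIdeal.isMaximal B).ne_top ((Ideal.eq_top_iff_one _).2 ?_)
      have := add_mem ((mem_maximalIdeal _).2 hn) ((maximalIdeal B).mul_mem_left c hm)
      simp at this
    refine hbK ((K.unit_mul_mem_iff_mem hunit).1 ?_)
    have : (1 - c * m) * b = k := by linear_combination -hc
    rwa [this]
  let φ : K.annihilator →ₗ[B] B := (LinearMap.toSpanSingleton B B b).comp K.annihilator.subtype
  have hφ : ∀ s : K.annihilator, φ s = (s : B) * b := fun s => rfl
  have hker : ∀ s : K.annihilator, φ s = 0 → (s : B) ∈ L.annihilator := by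
    intro s hs
    rw [Submodule.mem_annihilator]
    intro l hl
    rw [← h.sup_span_singleton_eq hbL hbK, sup_comm] at hl
    obtain ⟨c, k, hk, rfl⟩ := Ideal.mem_span_singleton_sup.1 hl
    have h1 := Submodule.mem_annihilator.1 s.2 k hk
    rw [hφ] at hs
    rw [smul_eq_mul] at h1 ⊢
    linear_combination c * hs + h1
  have hrange : LinearMap.range φ ≤ Ideal.span {u} := by
    rintro _ ⟨s, rfl⟩
    refine hsoc _ fun m hm => ?_
    have h1 := Submodule.mem_annihilator.1 s.2 _ (hmb m hm)
    rw [smul_eq_mul] at h1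
    rw [hφ]
    linear_combination h1
  have hspan : Module.length B (Ideal.span {u}) ≤ 1 := by
    let ψ : (B ⧸ maximalIdeal B) →ₗ[B] Ideal.span {u} :=
      (maximalIdeal B).liftQ (LinearMap.toSpanSingleton B _
        ⟨u, Ideal.mem_span_singleton_self u⟩) fun m hm => by
          rw [LinearMap.mem_ker]; ext; simpa using hu m hm
    have hψ : Function.Surjective ψ := by
      rintro ⟨y, hy⟩
      obtain ⟨c, rfl⟩ := Ideal.mem_span_singleton'.1 hy
      exact ⟨Submodule.Quotient.mk c, rfl⟩
    have : IsSimpleModule B (B ⧸ maximalIdeal B) :=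
      isSimpleModule_iff_isCoatom.2 (Ideal.isMaximal_def.1 inferInstance)
    exact (Module.length_le_of_surjective ψ hψ).trans (Module.length_eq_one B _).le
  rw [Module.length_eq_add_of_exact (LinearMap.ker φ).subtype φ.rangeRestrict
    (Submodule.subtype_injective _) φ.surjective_rangeRestrict
    (by rw [LinearMap.exact_iff, LinearMap.ker_rangeRestrict, Submodule.range_subtype])]
  refine add_le_add ?_ ((Module.length_le_of_injective (Submodule.inclusion hrange)
    (Submodule.inclusion_injective _)).trans hspan)
  refine Module.length_le_of_injective
    ((K.annihilator.subtype.comp (LinearMap.ker φ).subtype).codRestrict L.annihilator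
      fun s => hker s.1 s.2) ?_
  intro s t hst
  exact Subtype.ext (Subtype.ext (congrArg (fun z : L.annihilator => (z : B)) hst))

/-- Double annihilator property of Artinian local rings with principal socle, in the form that an
element outside `K` is separated from `K` by multiplication with some ring element. The sum of the
lengths of `K` and of its annihilator is monotone in `K` and takes the same value at `⊥` and at
`⊤`, so it is constant, and the annihilator is strictly antitone. -/
theorem exists_mul_eq_zero_and_mul_ne_zero [IsArtinianRing B] {u : B}
    (hu : ∀ m ∈ maximalIdeal B, m * u = 0)
    (hsoc : ∀ b, (∀ m ∈ maximalIdeal B, m * b = 0) → b ∈ Ideal.span {u})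
    {K : Ideal B} {b : B} (hb : b ∉ K) : ∃ s, (∀ k ∈ K, s * k = 0) ∧ s * b ≠ 0 := by
  let ℓ : Ideal B → ℕ∞ := fun K => Module.length B K
  let g : Ideal B → ℕ∞ := fun K => ℓ K + ℓ K.annihilator
  have hℓ : ∀ {K L : Ideal B}, K ⋖ L → ℓ L = ℓ K + 1 := fun h => h.length_eq
  have hg : ∀ {K L : Ideal B}, K ⋖ L → g K ≤ g L := fun {K L} h => by
    have h1 : ℓ K.annihilator ≤ ℓ L.annihilator + 1 := h.length_annihilator_le hu hsoc
    calc g K ≤ ℓ K + (ℓ L.annihilator + 1) := add_le_add le_rfl h1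
      _ = g L := by simp only [g, hℓ h]; ring
  have hbot : ∀ K : Ideal B, g ⊥ ≤ g K := by
    intro K
    induction K using WellFoundedLT.induction with
    | ind K ih =>
      rcases eq_or_ne K ⊥ with rfl | hK
      · exact le_rfl
      · obtain ⟨K', -, hK'⟩ := exists_le_covBy_of_lt (bot_lt_iff_ne_bot.2 hK)
        exact (ih K' hK'.lt).trans (hg hK')
  have htop : ∀ K : Ideal B, g K ≤ g ⊤ := by
    intro K
    induction K using WellFoundedGT.induction with
    | ind K ih =>
      rcases eq_or_ne K ⊤ with rfl | hK
      · exact le_rfl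
      · obtain ⟨K', hK', -⟩ := exists_covBy_le_of_lt (lt_top_iff_ne_top.2 hK)
        exact (hg hK').trans (ih K' hK'.lt)
  have hbt : g ⊤ = g ⊥ := by
    have h1 : (⊤ : Ideal B).annihilator = ⊥ := by
      rw [eq_bot_iff]
      intro s hs
      simpa using Submodule.mem_annihilator.1 hs 1 Submodule.mem_top
    have h2 : (⊥ : Ideal B).annihilator = ⊤ := Submodule.annihilator_bot
    simp only [g, h1, h2, add_comm]
  have hlt : K < K ⊔ Ideal.span {b} := by
    refine lt_of_le_of_ne le_sup_left fun h => hb ?_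
    rw [h]
    exact Ideal.mem_sup_right (Ideal.mem_span_singleton_self b)
  obtain ⟨L, hKL, hL⟩ := exists_covBy_le_of_lt hlt
  by_contra! hcon
  have hann : K.annihilator = L.annihilator := by
    refine le_antisymm (fun s hs => ?_) (Submodule.annihilator_mono hKL.le)
    rw [Submodule.mem_annihilator] at hs ⊢
    intro l hl
    obtain ⟨c, k, hk, rfl⟩ := Ideal.mem_span_singleton_sup.1 (sup_comm K _ ▸ hL hl)
    have h1 := hcon s hs
    have h2 := hs k hk
    rw [smul_eq_mul] at h2 ⊢
    linear_combination c * h1 + h2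
  have hgL : g L = g K + 1 := by
    simp only [g, hℓ hKL, hann]
    ring
  have hfin : g K ≠ ⊤ := by
    simp only [g, ne_eq, ENat.add_eq_top, not_or]
    exact ⟨Module.length_ne_top, Module.length_ne_top⟩
  have h3 : g K + 1 ≤ g K := hgL ▸ (htop L).trans (hbt.le.trans (hbot K))
  exact absurd h3 (not_le.2 ((ENat.lt_add_one_iff hfin).2 le_rfl))

/-- Every nonzero ideal contains the generator of the socle. -/
theorem mem_span_singleton_of_ne_zero [IsArtinianRing B] {u : B}
    (hu : ∀ m ∈ maximalIdeal B, m * u = 0)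
    (hsoc : ∀ b, (∀ m ∈ maximalIdeal B, m * b = 0) → b ∈ Ideal.span {u})
    {b : B} (hb : b ≠ 0) : u ∈ Ideal.span {b} := by
  by_contra hub
  obtain ⟨s, hs, hsu⟩ := exists_mul_eq_zero_and_mul_ne_zero hu hsoc hub
  have hunit : IsUnit s := by
    by_contra hn
    exact hsu (hu s ((mem_maximalIdeal _).2 hn))
  exact hb ((hunit.mul_right_eq_zero).1 (hs b (Ideal.mem_span_singleton_self b)))

end Duality

/-! ### Regular local rings and their systems of parameters -/

section RegularLocalRings

open IsLocalRing

theorem ringKrullDim_le_card_of_span_eq {R : Type*} [CommRing R] [IsLocalRing R]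
    [IsNoetherianRing R] {s : Finset R} (h : Ideal.span (s : Set R) = maximalIdeal R) :
    ringKrullDim R ≤ s.card := by
  refine (ringKrullDim_le_spanFinrank_maximalIdeal R).trans ?_
  rw [← h, ← Set.ncard_coe_finset s]
  exact_mod_cast Submodule.spanFinrank_span_le_ncard_of_finite s.finite_toSet

theorem IsRegularLocalRing.of_span_eq {R : Type*} [CommRing R] [IsLocalRing R]
    [IsNoetherianRing R] {s : Finset R} (h : Ideal.span (s : Set R) = maximalIdeal R)
    (hs : s.card ≤ ringKrullDim R) : IsRegularLocalRing R := by
  refine IsRegularLocalRing.of_spanFinrank_maximalIdeal_le _ (le_trans ?_ hs)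
  rw [← h, ← Set.ncard_coe_finset s]
  exact_mod_cast Submodule.spanFinrank_span_le_ncard_of_finite s.finite_toSet

/-- If the maximal ideal is generated by at most `dim R` elements, the quotient by some of them is
a regular local ring whose maximal ideal is generated by the remaining ones. -/
theorem IsRegularLocalRing.quotient_span {R : Type*} [CommRing R] [IsLocalRing R]
    [IsNoetherianRing R] [DecidableEq R] {s t : Finset R}
    (h : Ideal.span ((s ∪ t : Finset R) : Set R) = maximalIdeal R)
    (hst : ((s.card + t.card : ℕ) : WithBot ℕ∞) ≤ ringKrullDim R) :
    IsRegularLocalRing (R ⧸ Ideal.span (s : Set R)) ∧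
      ringKrullDim (R ⧸ Ideal.span (s : Set R)) ≤ t.card := by
  classical
  have hs : Ideal.span (s : Set R) ≤ maximalIdeal R := by
    rw [← h]; exact Ideal.span_mono (by simp)
  have : Nontrivial (R ⧸ Ideal.span (s : Set R)) :=
    Ideal.Quotient.nontrivial_iff.2 (ne_top_of_le_ne_top (maximalIdeal.isMaximal R).ne_top hs)
  have : IsLocalRing (R ⧸ Ideal.span (s : Set R)) :=
    IsLocalRing.of_surjective' (Ideal.Quotient.mk _) Ideal.Quotient.mk_surjective
  have hmax : Ideal.span ((t.image (Ideal.Quotient.mk (Ideal.span (s : Set R))) : Finset _) :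
      Set (R ⧸ Ideal.span (s : Set R))) = maximalIdeal _ := by
    have h1 : (maximalIdeal R).map (Ideal.Quotient.mk (Ideal.span (s : Set R))) =
        maximalIdeal (R ⧸ Ideal.span (s : Set R)) :=
      IsLocalRing.eq_maximalIdeal (Ideal.IsMaximal.map_of_surjective_of_ker_le
        Ideal.Quotient.mk_surjective (by simpa using hs))
    rw [← h1, ← h, Finset.coe_union, Ideal.span_union, Ideal.map_sup, Ideal.map_quotient_self,
      bot_sup_eq, Ideal.map_span, Finset.coe_image]
  have hcard : ((t.image (Ideal.Quotient.mk (Ideal.span (s : Set R)))).card : WithBot ℕ∞) ≤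
      t.card := by exact_mod_cast Finset.card_image_le
  refine ⟨IsRegularLocalRing.of_span_eq hmax (hcard.trans ?_),
    (ringKrullDim_le_card_of_span_eq hmax).trans hcard⟩
  have h2 := hst.trans (ringKrullDim_le_ringKrullDim_quotient_add_encard (s : Set R) (by
    rw [ringJacobson_eq_maximalIdeal]
    exact Ideal.span_le.1 hs))
  rw [Set.encard_coe_eq_coe_finsetCard, Nat.cast_add, add_comm] at h2
  generalize ringKrullDim (R ⧸ Ideal.span (s : Set R)) = D at h2
  induction D with
  | bot => simp at h2
  | coe D =>
    have h3 : (t.card : ℕ∞) + s.card ≤ D + s.card := by exact_mod_cast h2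
    exact_mod_cast (ENat.add_le_add_iff_right (ENat.natCast_ne_top _)).1 h3

/-- A regular local ring is an integral domain. By prime avoidance there is an element `x` of a
minimal generating system of the maximal ideal outside all minimal primes; by induction `R / (x)` is
a domain, so `(x)` is prime and a minimal prime below it vanishes by Nakayama's lemma. -/
theorem IsRegularLocalRing.isDomain (R : Type*) [CommRing R] [IsRegularLocalRing R] :
    IsDomain R := by
  classical
  induction hn : (maximalIdeal R).spanFinrank using Nat.strong_induction_on generalizing R with
  | _ n ih =>
  have hfg : (maximalIdeal R).FG := (maximalIdeal R).fg_of_isNoetherianRing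
  have hdim : (n : WithBot ℕ∞) = ringKrullDim R := by
    rw [← hn]; exact (isRegularLocalRing_iff R).1 inferInstance
  rcases Nat.eq_zero_or_pos n with h0 | hpos
  · have : maximalIdeal R = ⊥ := by
      rw [h0] at hn
      exact (Submodule.spanFinrank_eq_zero_iff_eq_bot hfg).1 hn
    exact (isField_iff_maximalIdeal_eq.2 this).isDomain
  -- an element of the maximal ideal outside its square and outside all minimal primes
  have hfin := minimalPrimes.finite_of_isNoetherianRing R
  obtain ⟨x, hxm, hx2, hxP⟩ : ∃ x ∈ maximalIdeal R, x ∉ maximalIdeal R ^ 2 ∧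
      ∀ P ∈ minimalPrimes R, x ∉ P := by
    by_contra! hcon
    have hsub : (maximalIdeal R : Set R) ⊆ (maximalIdeal R ^ 2 : Ideal R) ∪
        (maximalIdeal R ^ 2 : Ideal R) ∪ ⋃ i ∈ (hfin.toFinset : Set (Ideal R)), (id i : Ideal R) := by
      intro x hx
      by_cases h2 : x ∈ maximalIdeal R ^ 2
      · exact Or.inl (Or.inl h2)
      · obtain ⟨P, hP, hxP⟩ := hcon x hx h2
        exact Or.inr (Set.mem_biUnion (by simpa using hP) hxP)
    have hm2 : ¬ maximalIdeal R ≤ maximalIdeal R ^ 2 := by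
      intro h
      have h3 := Submodule.eq_bot_of_le_smul_of_le_jacobson_bot (maximalIdeal R) (maximalIdeal R)
        hfg (by rwa [smul_eq_mul, ← pow_two]) (maximalIdeal_le_jacobson _)
      rw [h3, Submodule.spanFinrank_bot] at hn
      omega
    rcases (Ideal.subset_union_prime' (fun i hi => (hfin.mem_toFinset.1 hi).1.1)).1 hsub with
      h | h | ⟨P, hP, h⟩
    · exact hm2 h
    · exact hm2 h
    · have hP' := hfin.mem_toFinset.1 hP
      have hmin : maximalIdeal R ∈ minimalPrimes R := by
        rwa [(maximalIdeal.isMaximal R).eq_of_le hP'.1.1.ne_top h]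
      have h4 := maximalIdeal_height_eq_ringKrullDim (R := R)
      rw [Ideal.height_eq_zero_iff.2 hmin, ← hdim] at h4
      have : 0 = n := by exact_mod_cast h4
      omega
  let G : Finset R := (Submodule.FG.finite_generators hfg).toFinset
  have hG : Ideal.span (G : Set R) = maximalIdeal R := by
    simpa [G] using (maximalIdeal R).span_generators
  have hGc : G.card = n := by
    rw [← hn, ← Submodule.FG.generators_ncard hfg, Set.ncard_eq_toFinset_card _
      (Submodule.FG.finite_generators hfg)]
  -- the element `x` can replace one of the generators
  obtain ⟨g, hgG, hg⟩ : ∃ g ∈ G, g ∈ Ideal.span ((({x} : Finset R) ∪ G.erase g : Finset R) :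
      Set R) := by
    have hx' := hxm
    rw [← hG] at hx'
    obtain ⟨a, ha⟩ := Submodule.mem_span_finset'.1 hx'
    obtain ⟨g, hg⟩ : ∃ g : G, IsUnit (a g) := by
      by_contra! hcon
      refine hx2 ?_
      rw [← ha, pow_two]
      exact sum_mem fun g _ => Ideal.mul_mem_mul ((mem_maximalIdeal _).2 (hcon g))
        (hG ▸ Ideal.subset_span g.2)
    refine ⟨g, g.2, (Ideal.unit_mul_mem_iff_mem _ hg).1 ?_⟩
    rw [← Finset.add_sum_erase _ _ (Finset.mem_univ g)] at ha
    have : a g * (g : R) = x - ∑ i ∈ Finset.univ.erase g, a i • (i : R) :=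
      eq_sub_of_add_eq ha
    rw [this]
    refine sub_mem (Ideal.subset_span (by simp)) (sum_mem fun i hi => ?_)
    refine Ideal.mul_mem_left _ _ (Ideal.subset_span ?_)
    have : (i : R) ≠ g := fun h => (Finset.ne_of_mem_erase hi) (Subtype.ext h)
    simp [this]
  have hspan : Ideal.span ((({x} : Finset R) ∪ G.erase g : Finset R) : Set R) =
      maximalIdeal R := by
    refine le_antisymm (Ideal.span_le.2 ?_) ?_
    · intro y hy
      rcases Finset.mem_union.1 (Finset.mem_coe.1 hy) with h | h
      · rw [Finset.mem_singleton.1 h]; exact hxm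
      · exact hG ▸ Ideal.subset_span (Finset.mem_of_mem_erase h)
    · rw [← hG]
      refine Ideal.span_le.2 fun y hy => ?_
      by_cases h : y = g
      · rw [h]; exact hg
      · exact Ideal.subset_span (by simp [h, Finset.mem_coe.1 hy])
  have hcard := Finset.card_erase_of_mem hgG
  obtain ⟨hreg, hle⟩ := IsRegularLocalRing.quotient_span hspan (by
    rw [hcard, hGc, ← hdim, Finset.card_singleton]
    exact_mod_cast (by omega : 1 + (n - 1) ≤ n))
  have hdom := ih (maximalIdeal (R ⧸ Ideal.span (({x} : Finset R) : Set R))).spanFinrank (by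
    rw [← (isRegularLocalRing_iff _).1 hreg, hcard, hGc] at hle
    exact lt_of_le_of_lt (Nat.cast_le.1 hle) (by omega)) _ rfl
  have hprime : (Ideal.span {x}).IsPrime := by
    have := (Ideal.Quotient.isDomain_iff_prime _).1 hdom
    simpa using this
  obtain ⟨P, hP, hPx⟩ := Ideal.exists_minimalPrimes_le (bot_le : (⊥ : Ideal R) ≤ Ideal.span {x})
  have hPprime : P.IsPrime := hP.1.1
  -- `P = x P`, so `P = 0` by Nakayama's lemma
  have hPbot : P = ⊥ := by
    refine Submodule.eq_bot_of_le_smul_of_le_jacobson_bot (maximalIdeal R) P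
      P.fg_of_isNoetherianRing ?_ (maximalIdeal_le_jacobson _)
    intro y hy
    obtain ⟨c, rfl⟩ := Ideal.mem_span_singleton'.1 (hPx hy)
    rw [mul_comm]
    exact Ideal.mul_mem_mul hxm ((hPprime.mem_or_mem hy).resolve_right (hxP P hP))
  rw [hPbot] at hPprime
  exact (IsDomain.of_bot_isPrime R)

theorem IsRegularLocalRing.exists_span_range_eq (R : Type*) [CommRing R] [IsRegularLocalRing R] :
    ∃ (d : ℕ) (x : Fin d → R), ringKrullDim R = d ∧ Ideal.span (Set.range x) = maximalIdeal R := by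
  have hfg : (maximalIdeal R).FG := (maximalIdeal R).fg_of_isNoetherianRing
  have hfin := Submodule.FG.finite_generators hfg
  have : Fintype (maximalIdeal R).generators := hfin.fintype
  refine ⟨(maximalIdeal R).spanFinrank,
    fun i => ((Fintype.equivFinOfCardEq (?_ : Fintype.card (maximalIdeal R).generators = _)).symm i),
    ((isRegularLocalRing_iff R).1 inferInstance).symm, ?_⟩
  · rw [← Submodule.FG.generators_ncard hfg, Set.ncard_eq_toFinset_card', Set.toFinset_card]
  · rw [Set.range_comp' Subtype.val, Equiv.range_eq_univ, Set.image_univ, Subtype.range_coe]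
    exact (maximalIdeal R).span_generators

/-- Any subset of a regular system of parameters generates a prime ideal, which contains no other
member of the system. -/
theorem IsRegularLocalRing.isPermutablyRegular {R : Type*} [CommRing R] [IsRegularLocalRing R]
    {ι : Type*} [Fintype ι] [DecidableEq ι] {x : ι → R} (hdim : ringKrullDim R = Fintype.card ι)
    (hx : Ideal.span (Set.range x) = maximalIdeal R) : IsPermutablyRegular x := by
  classical
  intro T j hj a ha
  have hcompl : T.card + Tᶜ.card = Fintype.card ι := Finset.card_add_card_compl T
  have hunion : ((T.image x ∪ Tᶜ.image x : Finset R) : Set R) = Set.range x := by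
    rw [← Finset.image_union, Finset.union_compl]; simp
  obtain ⟨hreg, -⟩ := IsRegularLocalRing.quotient_span (s := T.image x) (t := Tᶜ.image x)
    (by rw [hunion, hx]) (by
      rw [hdim, ← hcompl]
      exact_mod_cast add_le_add Finset.card_image_le Finset.card_image_le)
  have hprime := (Ideal.Quotient.isDomain_iff_prime _).1 (IsRegularLocalRing.isDomain
    (R ⧸ Ideal.span ((T.image x : Finset R) : Set R)))
  rw [Finset.coe_image] at hprime
  refine (hprime.mem_or_mem ha).resolve_left fun hxj => ?_
  have hspan : Ideal.span (((Finset.univ.erase j).image x : Finset R) : Set R) =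
      maximalIdeal R := by
    rw [← hx]
    refine le_antisymm (Ideal.span_mono (by intro y; simp; rintro z - rfl; exact ⟨z, rfl⟩)) ?_
    refine Ideal.span_le.2 ?_
    rintro _ ⟨i, rfl⟩
    by_cases hij : i = j
    · subst hij
      refine Ideal.span_mono ?_ hxj
      rw [Finset.coe_image]
      exact Set.image_mono fun k hk => by
        simpa using fun h : k = i => hj (h ▸ hk)
    · exact Ideal.subset_span (by simpa using ⟨i, hij, rfl⟩)
  have h1 := ringKrullDim_le_card_of_span_eq hspan
  rw [hdim] at h1
  have h2 : Fintype.card ι ≤ (Finset.univ.erase j).card :=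
    (by exact_mod_cast h1 : Fintype.card ι ≤ _).trans Finset.card_image_le
  rw [Finset.card_erase_of_mem (Finset.mem_univ j), Finset.card_univ] at h2
  have := Fintype.card_pos_iff.2 ⟨j⟩
  omega

end RegularLocalRings

/-! ### Completions of Noetherian and of regular local rings -/

section Completion

open IsLocalRing

/-- A ring `S` that is complete for the extension of an ideal `I` of a Noetherian ring `R`, and in
which `R` is dense, is Noetherian. For an ideal `J` of `S`, the approximations in `I ^ n` of
elements of `J` modulo `I ^ (n + 1) S` form a filtration of `R`, which is stable by the
Artin–Rees argument; lifts of generators of a stable piece generate `J ∩ I ^ n S` by successive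
approximation. -/
theorem isNoetherianRing_of_isAdicComplete_map {R S : Type*} [CommRing R] [IsNoetherianRing R]
    [CommRing S] [Algebra R S] (I : Ideal R)
    [IsAdicComplete (I.map (algebraMap R S)) S]
    (hdense : ∀ (n : ℕ) (s : S), ∃ r : R, s - algebraMap R S r ∈ I.map (algebraMap R S) ^ n) :
    IsNoetherianRing S := by
  set I' := I.map (algebraMap R S) with hI'
  have hmem : ∀ {n : ℕ} {r : R}, r ∈ I ^ n → algebraMap R S r ∈ I' ^ n := fun {n r} h => by
    rw [hI', ← Ideal.map_pow]; exact Ideal.mem_map_of_mem _ h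
  have happrox : ∀ (n : ℕ), ∀ s ∈ I' ^ n, ∃ r ∈ I ^ n, s - algebraMap R S r ∈ I' ^ (n + 1) := by
    intro n s hs
    rw [hI', ← Ideal.map_pow] at hs
    refine Submodule.span_induction ?_ ⟨0, zero_mem _, by simp⟩ ?_ ?_ hs
    · rintro _ ⟨r, hr, rfl⟩
      exact ⟨r, hr, by simp⟩
    · rintro a b - - ⟨r, hr, har⟩ ⟨t, ht, hbt⟩
      refine ⟨r + t, add_mem hr ht, ?_⟩
      rw [map_add, add_sub_add_comm]
      exact add_mem har hbt
    · rintro c a - ⟨r, hr, har⟩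
      obtain ⟨t, ht⟩ := hdense 1 c
      refine ⟨t * r, Ideal.mul_mem_left _ _ hr, ?_⟩
      have : c • a - algebraMap R S (t * r) =
          c * (a - algebraMap R S r) + algebraMap R S r * (c - algebraMap R S t) := by
        rw [map_mul, smul_eq_mul]; ring
      rw [this]
      refine add_mem (Ideal.mul_mem_left _ _ har) ?_
      rw [pow_succ]
      rw [pow_one] at ht
      exact Ideal.mul_mem_mul (hmem hr) ht
  refine ⟨fun J => ?_⟩
  -- the leading terms in `R` of the elements of `J`
  let F : I.Filtration R :=
    { N := fun n =>
        { carrier := {a | a ∈ I ^ n ∧ ∃ j ∈ J, j - algebraMap R S a ∈ I' ^ (n + 1)}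
          add_mem' := by
            rintro a b ⟨ha, j, hj, hja⟩ ⟨hb, k, hk, hkb⟩
            refine ⟨add_mem ha hb, j + k, add_mem hj hk, ?_⟩
            rw [map_add, add_sub_add_comm]
            exact add_mem hja hkb
          zero_mem' := ⟨zero_mem _, 0, zero_mem _, by simp⟩
          smul_mem' := by
            rintro c a ⟨ha, j, hj, hja⟩
            refine ⟨Ideal.mul_mem_left _ _ ha, algebraMap R S c * j, Ideal.mul_mem_left _ _ hj, ?_⟩
            rw [smul_eq_mul, map_mul, ← mul_sub]
            exact Ideal.mul_mem_left _ _ hja }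
      mono := by
        rintro n a ⟨ha, j, hj, hja⟩
        exact ⟨Ideal.pow_le_pow_right (Nat.le_succ n) ha, j, hj,
          Ideal.pow_le_pow_right (Nat.le_succ _) hja⟩
      smul_le := by
        intro n
        refine Submodule.smul_le.2 ?_
        rintro c hc a ⟨ha, j, hj, hja⟩
        refine ⟨?_, algebraMap R S c * j, Ideal.mul_mem_left _ _ hj, ?_⟩
        · rw [pow_succ', smul_eq_mul]
          exact Ideal.mul_mem_mul hc ha
        · rw [smul_eq_mul, map_mul, ← mul_sub, pow_succ']
          exact Ideal.mul_mem_mul (Ideal.mem_map_of_mem _ hc) hja }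
  have hF : F.Stable := by
    refine Ideal.Filtration.Stable.of_le (I.stableFiltration_stable (⊤ : Submodule R R)) ?_
    rintro n a ⟨ha, -⟩
    simpa [Ideal.stableFiltration] using ha
  obtain ⟨n₀, hn₀⟩ := hF.exists_pow_smul_eq
  obtain ⟨r, a, ha⟩ := Submodule.fg_iff_exists_fin_generating_family.1
    (IsNoetherian.noetherian (F.N n₀))
  have haN : ∀ i, a i ∈ F.N n₀ := fun i => ha ▸ Submodule.subset_span ⟨i, rfl⟩
  choose haI b hbJ hb using haN
  have hbI : ∀ i, b i ∈ I' ^ n₀ := fun i => by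
    have := add_mem (Ideal.pow_le_pow_right (Nat.le_succ n₀) (hb i)) (hmem (haI i))
    simpa using this
  -- stability of the filtration lets the leading term of `j` be written with the `b i`
  have hstep : ∀ (k : ℕ), ∀ j ∈ J, j ∈ I' ^ (n₀ + k) →
      ∃ c : Fin r → S, (∀ i, c i ∈ I' ^ k) ∧ j - ∑ i, c i * b i ∈ I' ^ (n₀ + (k + 1)) := by
    intro k j hj hjI
    obtain ⟨t, ht, hjt⟩ := happrox _ j hjI
    have htN : t ∈ I ^ k • F.N n₀ := by
      rw [← hn₀ k]
      exact ⟨ht, j, hj, hjt⟩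
    rw [← ha, Submodule.mem_ideal_smul_span_iff_exists_sum] at htN
    obtain ⟨c, hc, hct⟩ := htN
    rw [Finsupp.sum_fintype _ _ (by simp)] at hct
    refine ⟨fun i => algebraMap R S (c i), fun i => hmem (hc i), ?_⟩
    have : j - ∑ i, algebraMap R S (c i) * b i = (j - algebraMap R S t) -
        ∑ i, algebraMap R S (c i) * (b i - algebraMap R S (a i)) := by
      simp only [← hct, map_sum, smul_eq_mul, map_mul, mul_sub, Finset.sum_sub_distrib]
      ring
    rw [this]
    refine sub_mem hjt (sum_mem fun i _ => ?_)
    rw [show n₀ + (k + 1) = k + (n₀ + 1) by ring, pow_add]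
    exact Ideal.mul_mem_mul (hmem (hc i)) (hb i)
  have hJ : J ⊓ I' ^ n₀ = Ideal.span (Set.range b) := by
    refine le_antisymm ?_ (Ideal.span_le.2 ?_)
    swap
    · rintro _ ⟨i, rfl⟩
      exact ⟨hbJ i, hbI i⟩
    rintro j ⟨hj, hjI⟩
    -- successive approximations to the coefficients of `j`
    have hsum : ∀ C : Fin r → S, ∑ i, C i * b i ∈ J := fun C =>
      sum_mem fun i _ => Ideal.mul_mem_left _ _ (hbJ i)
    have hnext : ∀ (k : ℕ) (C : Fin r → S), j - ∑ i, C i * b i ∈ I' ^ (n₀ + k) →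
        ∃ C' : Fin r → S, (∀ i, C' i - C i ∈ I' ^ k) ∧
          j - ∑ i, C' i * b i ∈ I' ^ (n₀ + (k + 1)) := by
      intro k C hC
      obtain ⟨c, hc, h⟩ := hstep k _ (sub_mem hj (hsum C)) hC
      refine ⟨fun i => C i + c i, fun i => by simpa using hc i, ?_⟩
      simpa [add_mul, Finset.sum_add_distrib, sub_sub] using h
    choose! nxt hnxt₁ hnxt₂ using hnext
    let C : ℕ → Fin r → S := fun k => Nat.rec (fun _ => 0) (fun k c => nxt k c) k
    have hC : ∀ k, j - ∑ i, C k i * b i ∈ I' ^ (n₀ + k) := by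
      intro k
      induction k with
      | zero => simpa [C] using hjI
      | succ k ih => exact hnxt₂ k (C k) ih
    have hCd : ∀ k i, C (k + 1) i - C k i ∈ I' ^ k := fun k i => hnxt₁ k (C k) (hC k) i
    have hcauchy : ∀ i {m n : ℕ}, m ≤ n → C m i ≡ C n i [SMOD I' ^ m • (⊤ : Submodule S S)] := by
      intro i m n hmn
      induction n, hmn using Nat.le_induction with
      | base => rfl
      | succ n hmn ih =>
        refine ih.trans (SModEq.symm ?_)
        rw [SModEq.sub_mem]
        simpa using Ideal.pow_le_pow_right hmn (hCd n i)
    have hlim : ∀ i, ∃ L, ∀ n, C n i ≡ L [SMOD I' ^ n • (⊤ : Submodule S S)] := fun i =>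
      IsPrecomplete.prec inferInstance (hcauchy i)
    choose Λ hΛ using hlim
    have hj0 : j - ∑ i, Λ i * b i = 0 := by
      refine IsHausdorff.haus (I := I') inferInstance _ fun n => ?_
      rw [SModEq.sub_mem, sub_zero, smul_eq_mul, Ideal.mul_top]
      have : j - ∑ i, Λ i * b i = (j - ∑ i, C n i * b i) + ∑ i, (C n i - Λ i) * b i := by
        simp only [sub_mul, Finset.sum_sub_distrib]; ring
      rw [this]
      refine add_mem (Ideal.pow_le_pow_right (Nat.le_add_left _ _) (hC n)) (sum_mem fun i _ => ?_)
      refine Ideal.mul_mem_right _ _ ?_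
      simpa [SModEq.sub_mem] using hΛ i n
    rw [sub_eq_zero.1 hj0]
    exact sum_mem fun i _ => Ideal.mul_mem_left _ _ (Ideal.subset_span ⟨i, rfl⟩)
  have hquot : IsNoetherian R (S ⧸ I' ^ n₀) := by
    refine isNoetherian_of_surjective (Algebra.linearMap R (S ⧸ I' ^ n₀))
      (LinearMap.range_eq_top.2 fun y => ?_)
    obtain ⟨s, rfl⟩ := Ideal.Quotient.mk_surjective y
    obtain ⟨t, ht⟩ := hdense n₀ s
    exact ⟨t, (Ideal.Quotient.eq.2 ht).symm⟩
  refine Submodule.fg_of_fg_map_of_fg_inf_ker (Submodule.mkQ (I' ^ n₀)) ?_ ?_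
  · have : IsNoetherian S (S ⧸ I' ^ n₀) := isNoetherian_of_tower R hquot
    exact IsNoetherian.noetherian _
  · rw [Submodule.ker_mkQ, hJ]
    exact ⟨(Set.finite_range b).toFinset, by simp⟩

instance AdicCompletion.isNoetherianRing {R : Type*} [CommRing R] [IsNoetherianRing R]
    (I : Ideal R) : IsNoetherianRing (AdicCompletion I R) := by
  have hfg := I.fg_of_isNoetherianRing
  have := AdicCompletion.isAdicComplete_self I hfg
  refine isNoetherianRing_of_isAdicComplete_map I fun n s => ?_
  obtain ⟨r, hr⟩ := Submodule.Quotient.mk_surjective _ (AdicCompletion.eval I R n s)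
  refine ⟨r, ?_⟩
  rw [← Ideal.map_pow, ← Submodule.restrictScalars_mem R, ← Ideal.smul_top_eq_map,
    AdicCompletion.pow_smul_top_eq_ker_eval hfg, LinearMap.mem_ker, map_sub, ← hr]
  exact sub_self _

/-- The dimension does not drop under completion because flat extensions satisfy going down, and the
number of generators of the maximal ideal is preserved. -/
theorem AdicCompletion.isRegularLocalRing (R : Type*) [CommRing R] [IsRegularLocalRing R] :
    IsRegularLocalRing (AdicCompletion (maximalIdeal R) R) := by
  refine IsRegularLocalRing.of_spanFinrank_maximalIdeal_le _ ?_
  rw [AdicCompletion.spanFinrank_maximalIdeal_eq, (isRegularLocalRing_iff R).1 inferInstance,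
    ← maximalIdeal_height_eq_ringKrullDim, ← maximalIdeal_height_eq_ringKrullDim]
  have : (maximalIdeal (AdicCompletion (maximalIdeal R) R)).LiesOver (maximalIdeal R) :=
    ⟨(IsLocalRing.maximalIdeal_comap (algebraMap R (AdicCompletion (maximalIdeal R) R))).symm⟩
  rw [Ideal.height_eq_height_add_of_liesOver_of_hasGoingDown (maximalIdeal R)
    (maximalIdeal (AdicCompletion (maximalIdeal R) R))]
  exact_mod_cast le_self_add

end Completion

/-! ### The paraclass as a fraction -/

namespace TopCech

variable {R : Type u} [CommRing R] {d : ℕ} (x : Fin d → R)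

/-- The map `m ↦ m / (x_1 ⋯ x_d) ^ k` into the last term of the Čech complex. -/
noncomputable def frac (M : Type v) [AddCommGroup M] [Module R M] (k : ℕ) : M →ₗ[R] Last x M where
  toFun m := LocalizedModule.mk m ⟨(∏ j, x j) ^ k, pow_mem (Submonoid.mem_powers _) k⟩
  map_add' m n := by simp only [IsLocalizedModule.mk_eq_mk', IsLocalizedModule.mk'_add]
  map_smul' r m := by simp only [RingHom.id_apply, LocalizedModule.smul'_mk]

theorem frac_eq_frac_iff {M : Type v} [AddCommGroup M] [Module R M] {m n : M} {k l : ℕ} :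
    frac x M k m = frac x M l n ↔
      ∃ t, (∏ j, x j) ^ t • (∏ j, x j) ^ l • m = (∏ j, x j) ^ t • (∏ j, x j) ^ k • n := by
  rw [frac, frac, LinearMap.coe_mk, LinearMap.coe_mk, AddHom.coe_mk, AddHom.coe_mk,
    LocalizedModule.mk_eq]
  refine ⟨?_, ?_⟩
  · rintro ⟨⟨_, t, rfl⟩, h⟩
    exact ⟨t, h⟩
  · rintro ⟨t, h⟩
    exact ⟨⟨_, t, rfl⟩, h⟩

theorem frac_eq_frac_add {M : Type v} [AddCommGroup M] [Module R M] (m : M) (k l : ℕ) :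
    frac x M k m = frac x M (k + l) ((∏ j, x j) ^ l • m) :=
  (frac_eq_frac_iff x).2 ⟨0, by simp only [smul_smul, pow_add]⟩

theorem face_mk (i : Fin d) {M : Type v} [AddCommGroup M] [Module R M] (m : M) (k : ℕ)
    (hk : (∏ j ∈ Finset.univ.erase i, x j) ^ k ∈
      Submonoid.powers (∏ j ∈ Finset.univ.erase i, x j)) :
    face x i M (LocalizedModule.mk m ⟨(∏ j ∈ Finset.univ.erase i, x j) ^ k, hk⟩) =
      frac x M k (x i ^ k • m) := by
  refine ((Module.End.isUnit_iff _).1 (isUnit_penult x i M ⟨_, hk⟩)).1 ?_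
  simp only [Module.algebraMap_end_apply]
  rw [← map_smul, ← map_smul, LocalizedModule.smul'_mk, smul_smul, ← mul_pow,
    Finset.prod_erase_mul _ _ (Finset.mem_univ i)]
  have h1 : (LocalizedModule.mk ((∏ j ∈ Finset.univ.erase i, x j) ^ k • m)
      ⟨(∏ j ∈ Finset.univ.erase i, x j) ^ k, hk⟩ : Penult x i M) =
      LocalizedModule.mkLinearMap _ M m :=
    LocalizedModule.mk_cancel (S := Submonoid.powers (∏ j ∈ Finset.univ.erase i, x j))
      ⟨(∏ j ∈ Finset.univ.erase i, x j) ^ k, hk⟩ m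
  have h2 : frac x M k ((∏ j, x j) ^ k • m) = LocalizedModule.mkLinearMap _ M m :=
    LocalizedModule.mk_cancel (S := Submonoid.powers (∏ j, x j))
      ⟨(∏ j, x j) ^ k, pow_mem (Submonoid.mem_powers _) k⟩ m
  rw [h1, h2, face, IsLocalizedModule.lift_apply]

theorem paraclass_eq : paraclass x = (boundaries x R).mkQ (frac x R 1 1) := by
  simp only [paraclass, frac, LinearMap.coe_mk, AddHom.coe_mk, pow_one]

theorem lastMap_frac {M : Type v} [AddCommGroup M] [Module R M] {N : Type w} [AddCommGroup N]
    [Module R N] (f : M →ₗ[R] N) (m : M) (k : ℕ) :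
    lastMap x f (frac x M k m) = frac x N k (f m) := by
  simp only [frac, lastMap, LinearMap.coe_mk, AddHom.coe_mk, IsLocalizedModule.mk_eq_mk',
    IsLocalizedModule.map_mk']

/-- If the monomial `∏ x i ^ n` becomes a combination of the powers `x i ^ (n + 1)` in an algebra,
the paraclass vanishes there. -/
theorem map_paraclass_eq_zero {A : Type v} [CommRing A] [Algebra R A] {n : ℕ} (a : Fin d → A)
    (h : algebraMap R A ((∏ j, x j) ^ n) = ∑ i, x i ^ (n + 1) • a i) :
    map x (Algebra.linearMap R A) (paraclass x) = 0 := by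
  rw [paraclass_eq, map, Submodule.mkQ_apply, Submodule.mapQ_apply, lastMap_frac,
    Submodule.Quotient.mk_eq_zero, Algebra.linearMap_apply, map_one, frac_eq_frac_add x (1 : A) 1 n,
    ← Algebra.algebraMap_eq_smul_one, h, add_comm 1 n, map_sum]
  refine sum_mem fun i _ => ?_
  exact (le_iSup (fun i => LinearMap.range (face x i A)) i)
    ⟨_, face_mk x i (a i) (n + 1) (pow_mem (Submonoid.mem_powers _) _)⟩

theorem prod_pow_smul_mem {k : ℕ} (l : ℕ) {c : R}
    (hc : c ∈ powersIdeal x Finset.univ (fun _ => k)) :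
    (∏ j, x j) ^ l • c ∈ powersIdeal x Finset.univ (fun _ => k + l) := by
  refine Submodule.span_induction ?_ (by simp) (fun a b _ _ ha hb => ?_) (fun s a _ ha => ?_) hc
  · rintro _ ⟨i, hi, rfl⟩
    refine Ideal.mem_of_dvd _ ?_ (powersIdeal.pow_mem (Finset.mem_univ i))
    rw [smul_eq_mul, ← Finset.mul_prod_erase _ _ (Finset.mem_univ i), mul_pow]
    exact ⟨(∏ j ∈ Finset.univ.erase i, x j) ^ l, by ring⟩
  · rw [smul_add]; exact add_mem ha hb
  · rw [smul_comm]; exact Ideal.mul_mem_left _ _ ha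

/-- Classes in the image of the last differential are fractions `c / (∏ x i) ^ k` with `c` in the
ideal of the powers `x i ^ k`. -/
theorem exists_of_mem_boundaries {y : Last x R} (hy : y ∈ boundaries x R) :
    ∃ k, ∃ c ∈ powersIdeal x Finset.univ (fun _ => k),
      y = frac x R k c := by
  refine Submodule.iSup_induction _ (motive := fun y => ∃ k, ∃ c ∈ powersIdeal x Finset.univ
      (fun _ => k), y = frac x R k c) hy ?_ ?_ ?_
  · rintro i _ ⟨z, rfl⟩
    induction z using LocalizedModule.induction_on with
    | _ m s =>
    obtain ⟨_, k, rfl⟩ := s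
    exact ⟨k, x i ^ k • m, Ideal.mul_mem_right _ _ (powersIdeal.pow_mem (Finset.mem_univ i)),
      face_mk x i m k _⟩
  · exact ⟨0, 0, zero_mem _, (map_zero _).symm⟩
  · rintro _ _ ⟨k, c, hc, rfl⟩ ⟨l, b, hb, rfl⟩
    refine ⟨k + l, _,
      add_mem (prod_pow_smul_mem x l hc) (add_comm l k ▸ prod_pow_smul_mem x k hb), ?_⟩
    rw [frac_eq_frac_add x c k l, frac_eq_frac_add x b l k, map_add, add_comm l k]

/-- Over the ring itself the vanishing of the paraclass puts a monomial `∏ x i ^ n` into the ideal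
of the powers `x i ^ (n + 1)`. -/
theorem exists_pow_mem_of_paraclass_eq_zero (hx : ∏ j, x j ∈ nonZeroDivisors R)
    (h : paraclass x = 0) :
    ∃ n, ∏ j, x j ^ n ∈ powersIdeal x Finset.univ (fun _ => n + 1) := by
  rw [paraclass_eq, Submodule.mkQ_apply, Submodule.Quotient.mk_eq_zero] at h
  obtain ⟨k, c, hc, hk⟩ := exists_of_mem_boundaries x h
  obtain ⟨t, ht⟩ := (frac_eq_frac_iff x).1 hk
  simp only [smul_eq_mul, mul_one, pow_one] at ht
  rw [mul_cancel_left_mem_nonZeroDivisors (pow_mem hx t)] at ht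
  refine ⟨k, ?_⟩
  rw [Finset.prod_pow, ht]
  simpa using prod_pow_smul_mem x 1 hc

end TopCech

/-! ### Parasolid algebras and parasolid closure over regular rings -/

section RegularParasolid

open IsLocalRing

/-- In a regular local ring, an element outside an ideal `J` containing all `x i ^ (n + 1)` can be
multiplied to the monomial `∏ x i ^ n` modulo these powers by a multiplier that sends `J` into the
ideal they generate. -/
theorem IsRegularLocalRing.exists_mul_sub_mem {S : Type*} [CommRing S] [IsRegularLocalRing S]
    {ι : Type*} [Fintype ι] [DecidableEq ι] {x : ι → S} (hreg : IsPermutablyRegular x)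
    (hx : Ideal.span (Set.range x) = maximalIdeal S) {n : ℕ} {J : Ideal S}
    (hJ : powersIdeal x Finset.univ (fun _ => n + 1) ≤ J) {h : S} (hh : h ∉ J) :
    ∃ r, (∀ j ∈ J, r * j ∈ powersIdeal x Finset.univ (fun _ => n + 1)) ∧
      r * h - ∏ i, x i ^ n ∈ powersIdeal x Finset.univ (fun _ => n + 1) := by
  set Q := powersIdeal x Finset.univ (fun _ => n + 1) with hQ
  have hxm : ∀ i, x i ∈ maximalIdeal S := fun i => hx ▸ Ideal.subset_span ⟨i, rfl⟩
  have hQm : Q ≤ maximalIdeal S := by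
    refine Ideal.span_le.2 ?_
    rintro _ ⟨i, -, rfl⟩
    exact Ideal.pow_mem_of_mem _ (hxm i) _ n.succ_pos
  have : Nontrivial (S ⧸ Q) :=
    Ideal.Quotient.nontrivial_iff.2 (ne_top_of_le_ne_top (maximalIdeal.isMaximal S).ne_top hQm)
  have : IsLocalRing (S ⧸ Q) :=
    IsLocalRing.of_surjective' (Ideal.Quotient.mk _) Ideal.Quotient.mk_surjective
  have hmax : maximalIdeal (S ⧸ Q) =
      Ideal.span (Set.range fun i => Ideal.Quotient.mk Q (x i)) := by
    have h1 : (maximalIdeal S).map (Ideal.Quotient.mk Q) = maximalIdeal (S ⧸ Q) :=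
      IsLocalRing.eq_maximalIdeal (Ideal.IsMaximal.map_of_surjective_of_ker_le
        Ideal.Quotient.mk_surjective (by simpa using hQm))
    rw [← h1, ← hx, Ideal.map_span, ← Set.range_comp]
    rfl
  have hart : IsArtinianRing (S ⧸ Q) := by
    rw [isArtinianRing_iff_isNilpotent_maximalIdeal, Ideal.FG.isNilpotent_iff_le_nilradical
      (maximalIdeal (S ⧸ Q)).fg_of_isNoetherianRing, hmax, Ideal.span_le]
    rintro _ ⟨i, rfl⟩
    refine ⟨n + 1, ?_⟩
    rw [← map_pow, Ideal.zero_eq_bot, Ideal.mem_bot, Ideal.Quotient.eq_zero_iff_mem]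
    exact powersIdeal.pow_mem (e := fun _ => n + 1) (Finset.mem_univ i)
  have hu : ∀ m ∈ maximalIdeal (S ⧸ Q), m * Ideal.Quotient.mk Q (∏ i, x i ^ n) = 0 := by
    intro m hm
    rw [hmax] at hm
    refine Submodule.span_induction ?_ (by simp) (fun a b _ _ ha hb => ?_)
      (fun s a _ ha => ?_) hm
    · rintro _ ⟨i, rfl⟩
      rw [← map_mul, Ideal.Quotient.eq_zero_iff_mem, ← Finset.mul_prod_erase _ _ (Finset.mem_univ i),
        ← mul_assoc, ← pow_succ']
      exact Ideal.mul_mem_right _ _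
        (powersIdeal.pow_mem (e := fun _ => n + 1) (Finset.mem_univ i))
    · rw [add_mul, ha, hb, add_zero]
    · rw [smul_eq_mul, mul_assoc, ha, mul_zero]
  have hsoc : ∀ b : S ⧸ Q, (∀ m ∈ maximalIdeal (S ⧸ Q), m * b = 0) →
      b ∈ Ideal.span {Ideal.Quotient.mk Q (∏ i, x i ^ n)} := by
    intro b hb
    obtain ⟨a, rfl⟩ := Ideal.Quotient.mk_surjective b
    obtain ⟨c, hc⟩ := hreg.exists_sub_mem_of_forall_mul_mem (T := Finset.univ) (n := n) (a := a)
      fun j _ => by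
        rw [← hQ, ← Ideal.Quotient.eq_zero_iff_mem, map_mul]
        exact hb _ (hmax ▸ Ideal.subset_span ⟨j, rfl⟩)
    exact Ideal.mem_span_singleton'.2 ⟨Ideal.Quotient.mk Q c, by
      rw [← map_mul]; exact (Ideal.Quotient.eq.2 hc).symm⟩
  have hh' : Ideal.Quotient.mk Q h ∉ J.map (Ideal.Quotient.mk Q) := by
    rwa [Ideal.mem_quotient_iff_mem hJ]
  obtain ⟨s, hs, hsh⟩ := exists_mul_eq_zero_and_mul_ne_zero hu hsoc hh'
  obtain ⟨t, ht⟩ := Ideal.mem_span_singleton'.1 (mem_span_singleton_of_ne_zero hu hsoc hsh)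
  obtain ⟨r, hr⟩ := Ideal.Quotient.mk_surjective (t * s)
  refine ⟨r, fun j hj => ?_, ?_⟩
  · rw [← Ideal.Quotient.eq_zero_iff_mem, map_mul, hr, mul_assoc,
      hs _ (Ideal.mem_map_of_mem _ hj), mul_zero]
  · rw [← Ideal.Quotient.eq, map_mul, hr, mul_assoc, ht]

theorem IsPermutablyRegular.paraclass_ne_zero {S : Type u} [CommRing S] [IsLocalRing S] {d : ℕ}
    {x : Fin d → S} (hreg : IsPermutablyRegular x)
    (hx : Ideal.span (Set.range x) = maximalIdeal S) : TopCech.paraclass x ≠ 0 := by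
  intro h
  have hnzd : ∏ j, x j ∈ nonZeroDivisors S := by
    refine prod_mem fun j _ => mem_nonZeroDivisors_iff_right.2 fun a ha => ?_
    have := hreg ∅ j (Finset.notMem_empty j) a (by rw [mul_comm, ha]; exact zero_mem _)
    simpa using this
  obtain ⟨n, hn⟩ := TopCech.exists_pow_mem_of_paraclass_eq_zero x hnzd h
  refine hreg.prod_pow_notMem ?_ n hn
  rw [Finset.coe_univ, Set.image_univ, hx]
  exact (maximalIdeal.isMaximal S).ne_top

/-- If an ideal of a regular local ring forces an element in a parasolid algebra, it contains the
element. By Krull's intersection theorem an element `h` outside `I = (f)` lies outside some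
`I + 𝔪 ^ N`; multiplying the forcing equation by a suitable element turns `h` into the monomial
`∏ x i ^ N` and the `f i` into elements of `(x i ^ (N + 1))`, which annihilates the paraclass. -/
theorem IsRegularLocalRing.mem_span_of_isParasolid {S : Type u} [CommRing S] [IsRegularLocalRing S]
    {A : Type v} [CommRing A] [Algebra S A] (hA : IsParasolid S A) {n : ℕ} (f : Fin n → S) (h : S)
    (t : Fin n → A) (ht : ∑ i, f i • t i + algebraMap S A h = 0) :
    h ∈ Ideal.span (Set.range f) := by
  obtain ⟨d, x, hd, hx⟩ := IsRegularLocalRing.exists_span_range_eq S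
  have hreg : IsPermutablyRegular x :=
    IsRegularLocalRing.isPermutablyRegular (by rw [hd, Fintype.card_fin]) hx
  by_contra hh
  set I := Ideal.span (Set.range f)
  obtain ⟨N, hN⟩ : ∃ N, h ∉ I ⊔ maximalIdeal S ^ N := by
    by_contra! hcon
    refine hh (Ideal.Quotient.eq_zero_iff_mem.1 ?_)
    refine IsHausdorff.haus (I := maximalIdeal S) (M := S ⧸ I) inferInstance _ fun N => ?_
    obtain ⟨a, ha, b, hb, hab⟩ := Submodule.mem_sup.1 (hcon N)
    rw [SModEq.sub_mem, sub_zero, ← hab, map_add, Ideal.Quotient.eq_zero_iff_mem.2 ha, zero_add]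
    have : Ideal.Quotient.mk I b = b • (1 : S ⧸ I) := by
      rw [Algebra.smul_def, mul_one]; rfl
    rw [this]
    exact Submodule.smul_mem_smul hb Submodule.mem_top
  have hQ : powersIdeal x Finset.univ (fun _ => N + 1) ≤ I ⊔ maximalIdeal S ^ N := by
    refine le_trans (Ideal.span_le.2 ?_) le_sup_right
    rintro _ ⟨i, -, rfl⟩
    exact Ideal.pow_le_pow_right (Nat.le_succ N)
      (Ideal.pow_mem_pow (hx ▸ Ideal.subset_span ⟨i, rfl⟩) _)
  obtain ⟨r, hrJ, hrh⟩ := exists_mul_sub_mem hreg hx hQ hN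
  have hmap : algebraMap S A ((∏ i, x i) ^ N) ∈
      (powersIdeal x Finset.univ (fun _ => N + 1)).map (algebraMap S A) := by
    have h1 : algebraMap S A ((∏ i, x i) ^ N) =
        -algebraMap S A (r * h - ∏ i, x i ^ N) - ∑ i, algebraMap S A (r * f i) * t i := by
      have h2 : ∑ i, algebraMap S A (r * f i) * t i = algebraMap S A r * ∑ i, f i • t i := by
        rw [Finset.mul_sum]
        exact Finset.sum_congr rfl fun i _ => by rw [Algebra.smul_def, map_mul, mul_assoc]
      rw [h2, eq_neg_of_add_eq_zero_left ht, Finset.prod_pow, map_sub, map_mul]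
      ring
    rw [h1]
    refine sub_mem (neg_mem (Ideal.mem_map_of_mem _ hrh)) (sum_mem fun i _ => ?_)
    exact Ideal.mul_mem_right _ _ (Ideal.mem_map_of_mem _
      (hrJ _ (Ideal.mem_sup_left (Ideal.subset_span ⟨i, rfl⟩))))
  rw [powersIdeal, Ideal.map_span, Finset.coe_univ, Set.image_univ, ← Set.range_comp,
    Ideal.mem_span_range_iff_exists_fun] at hmap
  obtain ⟨a, ha⟩ := hmap
  refine hA d x ⟨hd, ?_⟩ (hreg.paraclass_ne_zero hx) (TopCech.map_paraclass_eq_zero x a (n := N) ?_)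
  · rw [← hx, PrimeSpectrum.zeroLocus_span]
  · rw [← ha]
    exact Finset.sum_congr rfl fun i _ => by rw [Algebra.smul_def, mul_comm]; rfl

theorem BelongsUniversallyParasolidly.mem_span {S : Type u} [CommRing S] [IsRegularLocalRing S]
    {n : ℕ} {f : Fin n → S} {h : S} (H : BelongsUniversallyParasolidly f h) :
    h ∈ Ideal.span (Set.range f) := by
  let g : ForcingAlgebra f h →ₐ[S] S ⊗[S] ForcingAlgebra f h :=
    Algebra.TensorProduct.includeRight
  refine IsRegularLocalRing.mem_span_of_isParasolid (H S) f h
    (fun i => g (Ideal.Quotient.mk _ (MvPolynomial.X i))) ?_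
  have h1 : (Ideal.Quotient.mk _ (∑ i, MvPolynomial.C (f i) * MvPolynomial.X i + MvPolynomial.C h) :
      ForcingAlgebra f h) = 0 :=
    Ideal.Quotient.eq_zero_iff_mem.2 (Ideal.mem_span_singleton_self _)
  have h2 := congrArg g h1
  rw [map_zero, map_add, map_add, map_sum, map_sum] at h2
  rw [← h2, ← g.commutes h]
  congr 1
  refine Finset.sum_congr rfl fun i _ => ?_
  rw [map_mul, map_mul, Algebra.smul_def, ← g.commutes (f i)]
  rfl

/-- Each member of the chain already lies in the ideal of the preceding ones, so the ideal does not
grow along the chain. -/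
theorem ParasolidChain.mem_span {S : Type u} [CommRing S] [IsRegularLocalRing S]
    {n : ℕ} {f : Fin n → S} {h : S} (H : ParasolidChain f h) : h ∈ Ideal.span (Set.range f) := by
  induction H with
  | last f h H => exact H.mem_span
  | step f g h H _ ih =>
    refine Ideal.span_le.2 ?_ ih
    rintro _ ⟨i, rfl⟩
    refine Fin.lastCases ?_ (fun i => ?_) i
    · rw [Fin.snoc_last]; exact H.mem_span
    · rw [Fin.snoc_castSucc]; exact Ideal.subset_span ⟨i, rfl⟩

/-- An algebra with a retraction to the base ring is parasolid. -/
theorem IsParasolid.of_algHom {R : Type u} [CommRing R] [IsLocalRing R] {A : Type v} [CommRing A]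
    [Algebra R A] (σ : A →ₐ[R] R) : IsParasolid R A := by
  intro d x _ hne h0
  refine hne ?_
  have h1 := congrArg (TopCech.map x σ.toLinearMap) h0
  rw [map_zero, TopCech.paraclass_eq, TopCech.map, TopCech.map, Submodule.mkQ_apply,
    Submodule.mapQ_apply, Submodule.mapQ_apply, TopCech.lastMap_frac, TopCech.lastMap_frac] at h1
  rw [TopCech.paraclass_eq, Submodule.mkQ_apply]
  simpa using h1

theorem BelongsUniversallyParasolidly.of_mem_span {R : Type u} [CommRing R] {n : ℕ}
    {f : Fin n → R} {h : R} (hh : h ∈ Ideal.span (Set.range f)) :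
    BelongsUniversallyParasolidly f h := by
  intro R' _ _ _ _
  obtain ⟨c, hc⟩ := Ideal.mem_span_range_iff_exists_fun.1 hh
  -- the retraction sends `X i` to `-c i`, where `h = ∑ c i * f i`
  let σ : ForcingAlgebra f h →ₐ[R] R :=
    Ideal.Quotient.liftₐ _ (MvPolynomial.aeval fun i => -c i) fun a ha => by
      obtain ⟨b, rfl⟩ := Ideal.mem_span_singleton'.1 ha
      have : ∑ i, f i * -c i + h = 0 := by
        rw [← hc]
        simp [mul_comm]
      simp only [map_mul, map_add, map_sum, MvPolynomial.aeval_X, MvPolynomial.aeval_C,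
        Algebra.algebraMap_self, RingHom.id_apply, this, mul_zero]
  exact IsParasolid.of_algHom (Algebra.TensorProduct.lift (AlgHom.id R' R')
    ((Algebra.ofId R R').comp σ) fun _ _ => Commute.all _ _)

/-- Membership in the closure is tested at the zero ideal, the minimal prime of each completion, where
it gives membership in the extended ideal, which descends. -/
theorem parasolidClosure_eq_of_isRegularLocalRing_localization {R : Type u} [CommRing R]
    [IsNoetherianRing R]
    (hR : ∀ (m : Ideal R) [m.IsMaximal], IsRegularLocalRing (Localization.AtPrime m))
    (I : Ideal R) : parasolidClosure I = (I : Set R) := by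
  refine Set.Subset.antisymm (fun h hh => ?_) fun h hh => ?_
  · refine (Ideal.span_singleton_le_iff_mem (I := I)).1
      (Ideal.le_of_localization_maximal fun m hm => ?_)
    rw [Ideal.map_span, Set.image_singleton, Ideal.span_singleton_le_iff_mem]
    have := hR m
    have := AdicCompletion.isRegularLocalRing (Localization.AtPrime m)
    have := IsRegularLocalRing.isDomain (CompletedLocalization m)
    have : IsRegularLocalRing (CompletedLocalization m ⧸ (⊥ : Ideal (CompletedLocalization m))) :=
      IsRegularLocalRing.of_ringEquiv (RingEquiv.quotientBot _).symm
    obtain ⟨n, f, hf, hchain⟩ := hh m ⊥ (by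
      rw [IsDomain.minimalPrimes_eq_singleton_bot]; rfl)
    have h1 := hchain.mem_span
    rw [hf, toLocalCompleteDomain, ← Ideal.map_map, ← Ideal.map_map, RingHom.comp_apply,
      Ideal.mem_quotient_iff_mem bot_le, RingHom.comp_apply, ← Ideal.mem_comap] at h1
    have : Module.FaithfullyFlat (Localization.AtPrime m) (CompletedLocalization m) :=
      Module.FaithfullyFlat.of_flat_of_isLocalHom
    rwa [Ideal.comap_map_eq_self_of_faithfullyFlat] at h1
  · intro m _ q _
    obtain ⟨n, f, hf⟩ := Submodule.fg_iff_exists_fin_generating_family.1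
      (I.fg_of_isNoetherianRing.map (toLocalCompleteDomain m q))
    refine ⟨n, f, hf, .last f _ (.of_mem_span ?_)⟩
    rw [Ideal.span, hf]
    exact Ideal.mem_map_of_mem _ hh

end RegularParasolid

theorem mainTheorem1 :
    (∀ (R : Type u) [CommRing R] [IsRegularLocalRing R] (I : Ideal R),
      parasolidClosure I = (I : Set R)) ∧
    (∀ (R : Type u) [CommRing R] [IsRegularRing R], IsPararegular R) := by
  refine ⟨fun R _ _ I => ?_, fun R _ _ => ⟨inferInstance, fun I => ?_⟩⟩
  · refine parasolidClosure_eq_of_isRegularLocalRing_localization (fun m hm => ?_) I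
    obtain rfl := IsLocalRing.eq_maximalIdeal hm
    exact IsRegularLocalRing.of_ringEquiv (IsLocalization.atUnits R
      (IsLocalRing.maximalIdeal R).primeCompl
      (S := Localization.AtPrime (IsLocalRing.maximalIdeal R))
      (fun x => by simp [IsUnit.mem_submonoid_iff])).toRingEquiv
  · exact parasolidClosure_eq_of_isRegularLocalRing_localization (fun m _ => inferInstance) I
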